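/- For a positive integer $n$ and $r\ge 1$ let $\sigma_r(n)=\sum_{d\mid n}d^r$ (sum over positive divisors), $\sigma=\sigma_1$, and put $\sigma_r(x)=0$ if $x$ is a rational number that is not a positive integer. For positive integers $a,b,r,s,n$ let $$W^{r,s}_{a,b}(n)=\sum_{\substack{l,m\ge 1\\ al+bm=n}}\sigma_r(l)\sigma_s(m),\qquad W_{a,b}(n)=W^{1,1}_{a,b}(n).$$ Let $M_6(N)$ be the complex vector space of modular forms of weight $6$ on $\Gamma_0(N)$ with trivial character, and $\lambda_6(N)$ its (finite) dimension. **Theorem.** Let $a$ and $b$ be positive integers with $\gcd(a,b)=1$, at least one of them greater than $1$. Let $F_1,\dots,F_{\lambda_6(ab)}$ be any basis of $M_6(ab)$, and let $A_i(n)$ be the $n$-th Fourier coefficient of $F_i$, i.e. the coefficient of $q^n$, $q=e^{2\pi i z}$. Then there exist constants $\delta_i\in\mathbb C$, $1\le i\le\lambda_6(ab)$, independent of $n$, such that for all integers $n\ge 2$ $$\begin{aligned}\sum_{\substack{l,m\ge 1\\ al+bm=n}} l\,\sigma(l)\sigma(m) ={}& \frac{1}{144a}\Big(\frac{6}{b}n^2+3n-\frac{2an}{b}\Big)\sigma(n/a)+\frac{1}{144a}\Big(\frac{6}{a}n^2-3n+\frac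 a3\Big)\sigma(n/b)-\frac{5}{216}\,\sigma_3(n/a)\\ &+\frac{n}{2a}W_{a,b}(n)+\frac59 W^{1,3}_{b,a}(n)+\frac{a}{3b}\sum_{\substack{l,m\ge 1\\ l+m=n/a}} l\,\sigma(l)\sigma(m)+\frac{1}{6\cdot 576\,a}\sum_{i=1}^{\lambda_6(ab)}\delta_iA_i(n),\end{aligned}$$ where the sum over $l+m=n/a$ is $0$ if $a\nmid n$. -/

import Mathlib

/-- The space `M_k(N)` of modular forms of weight `k` on `Γ₀(N)` with trivial character. -/
abbrev ModForms (N k : ℕ) : Type :=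
  ModularForm ((CongruenceSubgroup.Gamma0 N).map (Matrix.SpecialLinearGroup.mapGL ℝ)) (k : ℤ)

/-- The `n`-th Fourier coefficient of `f ∈ M_k(N)` at infinity, that is, the coefficient of `q ^ n`
in the expansion in `q = exp (2 π i z)`. -/
noncomputable def modFormCoeff {N k : ℕ} (f : ModForms N k) (n : ℕ) : ℂ :=
  (UpperHalfPlane.qExpansion 1 f).coeff n

/-- `g (n / a)`, for a function `g` on the positive integers that is extended by `0` to all other
rational arguments (`n` and `a` are positive). -/
def atQuot (g : ℕ → ℕ) (n a : ℕ) : ℕ :=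
  if a ∣ n then g (n / a) else 0

/-- The convolution sum `∑ l ^ e * σ_r(l) * σ_s(m)` over all pairs `(l, m)` of positive integers
with `a * l + b * m = n` (`a` and `b` are positive, so that `l, m ≤ n`). -/
def convSum (e r s a b n : ℕ) : ℕ :=
  ∑ p ∈ (Finset.Icc 1 n ×ˢ Finset.Icc 1 n).filter (fun p : ℕ × ℕ => a * p.1 + b * p.2 = n),
    p.1 ^ e * ArithmeticFunction.sigma r p.1 * ArithmeticFunction.sigma s p.2

/-!
`E₂` is quasimodular and satisfies Ramanujan's equation `12 θ E₂ = E₂² - E₄`, where `θ = q d/dq`.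
Hence `x = a E₂(a τ)` and `P = a² E₄(a τ)` satisfy `12 θ x = x² - P`, and likewise
`12 θ y = y² - Q` for `y = b E₂(b τ)` and `Q = b² E₄(b τ)`. These equations turn a combination of
`y θ x`, `θ (x y)`, `P y`, `θ² x`, `θ² y` and `x θ x`, whose coefficients carry the convolution
sums, into a polynomial in `x - y`, `P`, `Q` and the Serre derivatives `x P - 3 θ P` and
`y Q - 3 θ Q`. These are modular on `Γ₀(N)` for every common multiple `N` of `a` and `b`; for
`x - y` this is because `x` and `y` deviate from modularity by the same term.
-/

section

open UpperHalfPlane hiding I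
open ModularForm Complex PowerSeries Derivative EisensteinSeries
open scoped Manifold MatrixGroups Topology
open CongruenceSubgroup (Gamma0)
open Function.Periodic (qParam)
open Matrix.SpecialLinearGroup (mapGL)

/-! ### Expansions in `q` -/

/-- The derivation `θ = q d/dq` of formal power series in `q`. -/
noncomputable def thetaDeriv (R : Type*) [CommSemiring R] : Derivation R R⟦X⟧ R⟦X⟧ :=
  (X : R⟦X⟧) • d⁄dX R

section thetaDeriv

variable {R : Type*} [CommSemiring R]

lemma coeff_thetaDeriv (p : R⟦X⟧) (n : ℕ) : (thetaDeriv R p).coeff n = n * p.coeff n := by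
  cases n with
  | zero => simp [thetaDeriv]
  | succ n =>
    rw [thetaDeriv, Derivation.smul_apply, smul_eq_mul, coeff_succ_X_mul, coeff_derivative]
    push_cast
    ring

lemma constantCoeff_thetaDeriv (p : R⟦X⟧) : constantCoeff (thetaDeriv R p) = 0 := by
  simp [thetaDeriv]

end thetaDeriv

lemma thetaDeriv_expand {R : Type*} [CommRing R] {a : ℕ} (ha : a ≠ 0) (p : R⟦X⟧) :
    thetaDeriv R (p.expand a ha) = (a : R) • (thetaDeriv R p).expand a ha := by
  ext n
  rw [coeff_thetaDeriv, map_smul, smul_eq_mul, coeff_expand, coeff_expand]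
  split_ifs with h
  · obtain ⟨m, rfl⟩ := h
    rw [Nat.mul_div_cancel_left _ (Nat.pos_of_ne_zero ha), coeff_thetaDeriv]
    push_cast
    ring
  · simp

/-- The generating series of the divisor sums `σ_k`. -/
noncomputable def sigmaSeries (R : Type*) [Semiring R] (k : ℕ) : R⟦X⟧ :=
  .mk fun n ↦ (ArithmeticFunction.sigma k n : R)

lemma constantCoeff_sigmaSeries (R : Type*) [Semiring R] (k : ℕ) :
    constantCoeff (sigmaSeries R k) = 0 := by
  simp [sigmaSeries]

lemma hasDerivAt_qParam_one (w : ℂ) :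
    HasDerivAt (qParam 1) (2 * Real.pi * I * qParam 1 w) w := by
  have h := ((hasDerivAt_id w).const_mul (2 * Real.pi * I)).cexp
  refine (h.congr_of_eventuallyEq (.of_forall fun z ↦ ?_)).congr_deriv ?_ <;>
    simp [qParam, mul_comm]

/-- `f` is given on the whole upper half plane by the power series `p` in `q = exp (2 π i τ)`. -/
def HasQExp (f : ℍ → ℂ) (p : ℂ⟦X⟧) : Prop :=
  ∀ τ : ℍ, HasSum (fun m ↦ p.coeff m * qParam 1 τ ^ m) (f τ)

namespace HasQExp

variable {f g : ℍ → ℂ} {p r : ℂ⟦X⟧}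

lemma zero : HasQExp 0 0 := fun τ ↦ by simp [hasSum_zero]

lemma add (hf : HasQExp f p) (hg : HasQExp g r) : HasQExp (f + g) (p + r) := fun τ ↦ by
  simpa [add_mul] using (hf τ).add (hg τ)

lemma sum {ι : Type*} {F : ι → ℍ → ℂ} {P : ι → ℂ⟦X⟧} (s : Finset ι)
    (h : ∀ i ∈ s, HasQExp (F i) (P i)) : HasQExp (∑ i ∈ s, F i) (∑ i ∈ s, P i) := fun τ ↦ by
  simpa [Finset.sum_mul] using hasSum_sum fun i hi ↦ h i hi τ

lemma smul (c : ℂ) (hf : HasQExp f p) : HasQExp (c • f) (c • p) := fun τ ↦ by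
  simpa [mul_assoc] using (hf τ).mul_left c

lemma sub (hf : HasQExp f p) (hg : HasQExp g r) : HasQExp (f - g) (p - r) := fun τ ↦ by
  simpa [sub_mul] using (hf τ).sub (hg τ)

lemma mul (hf : HasQExp f p) (hg : HasQExp g r) : HasQExp (f * g) (p * r) := fun τ ↦ by
  have hfτ := (hf τ).summable.norm
  have hgτ := (hg τ).summable.norm
  rw [Pi.mul_apply, ← (hf τ).tsum_eq, ← (hg τ).tsum_eq,
    tsum_mul_tsum_eq_tsum_sum_antidiagonal_of_summable_norm hfτ hgτ]
  refine (summable_norm_sum_mul_antidiagonal_of_summable_norm hfτ hgτ).of_norm.hasSum.congr_fun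
    fun n ↦ ?_
  rw [coeff_mul, Finset.sum_mul]
  refine Finset.sum_congr rfl fun k hk ↦ ?_
  rw [← Finset.HasAntidiagonal.mem_antidiagonal.mp hk, pow_add]
  ring

lemma isBoundedAtImInfty (hf : HasQExp f p) : IsBoundedAtImInfty f :=
  isBoundedAtImInfty_of_hasSum_qExpansion one_pos hf

lemma dilate {a : ℕ} (ha : a ≠ 0) (hf : HasQExp f p) {d : ℍ → ℍ}
    (hd : ∀ τ, (d τ : ℂ) = a * τ) : HasQExp (f ∘ d) (p.expand a ha) := fun τ ↦ by
  have hq : qParam 1 (d τ : ℂ) = qParam 1 (τ : ℂ) ^ a := by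
    simp only [qParam, hd, ← Complex.exp_nat_mul]
    congr 1
    ring
  have hinj : Function.Injective (a * · : ℕ → ℕ) := fun _ _ ↦ Nat.eq_of_mul_eq_mul_left ha.bot_lt
  rw [← hinj.hasSum_iff]
  · simpa [Function.comp_def, coeff_expand_mul, pow_mul, hq] using hf (d τ)
  · intro m hm
    rw [coeff_expand_of_not_dvd _ _ _ fun ⟨k, hk⟩ ↦ hm ⟨k, hk.symm⟩, zero_mul]

lemma comp_ofComplex_eventuallyEq (hf : HasQExp f p) (τ : ℍ) :
    f ∘ ofComplex =ᶠ[𝓝 (τ : ℂ)] fun w ↦ ∑' m, p.coeff m * qParam 1 w ^ m := by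
  filter_upwards [isOpen_upperHalfPlaneSet.mem_nhds τ.im_pos] with w hw
  rw [Function.comp_apply, ofComplex_apply_of_im_pos hw, ← (hf ⟨w, hw⟩).tsum_eq]

lemma exists_summable_bound (hf : HasQExp f p) (τ : ℍ) :
    ∃ U : Set ℂ, IsOpen U ∧ (τ : ℂ) ∈ U ∧ ∃ u : ℕ → ℝ, Summable u ∧
      ∀ m, ∀ w ∈ U, ‖p.coeff m * qParam 1 w ^ m‖ ≤ u m := by
  let ρ : ℍ := ⟨(τ.im / 2 : ℝ) * I, by simpa using τ.im_pos⟩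
  refine ⟨{w | (ρ : ℂ).im < w.im}, isOpen_lt continuous_const continuous_im, ?_,
    _, (hf ρ).summable.norm, fun m w hw ↦ ?_⟩
  · simpa [ρ] using τ.im_pos
  · simp only [norm_mul, norm_pow, Function.Periodic.norm_qParam]
    have : (ρ : ℂ).im < w.im := hw
    gcongr ?_ * Real.exp ?_ ^ m
    nlinarith [Real.pi_pos]

lemma mdifferentiable (hf : HasQExp f p) : MDiff f := fun τ ↦ by
  obtain ⟨U, hU, hτ, u, hu, hle⟩ := hf.exists_summable_bound τ
  rw [mdifferentiableAt_iff]
  refine DifferentiableAt.congr_of_eventuallyEq ?_ (hf.comp_ofComplex_eventuallyEq τ)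
  refine (differentiableOn_tsum_of_summable_norm hu (fun m ↦ ?_) hU hle).differentiableAt
    (hU.mem_nhds hτ)
  exact (((Function.Periodic.differentiable_qParam).pow m).const_mul _).differentiableOn

lemma normalizedDeriv (hf : HasQExp f p) : HasQExp (D f) (thetaDeriv ℂ p) := fun τ ↦ by
  obtain ⟨U, hU, hτ, u, hu, hle⟩ := hf.exists_summable_bound τ
  have hterm (m : ℕ) (w : ℂ) : HasDerivAt (fun w ↦ p.coeff m * qParam 1 w ^ m)
      (2 * Real.pi * I * (m * p.coeff m * qParam 1 w ^ m)) w := by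
    refine (((hasDerivAt_qParam_one w).pow m).const_mul _).congr_deriv ?_
    cases m with
    | zero => simp
    | succ m => rw [Nat.add_sub_cancel, pow_succ]; push_cast; ring
  have hsum := hasSum_deriv_of_summable_norm hu
    (fun m w _ ↦ (hterm m w).differentiableAt.differentiableWithinAt) hU hle hτ
  rw [← (hf.comp_ofComplex_eventuallyEq τ).deriv_eq] at hsum
  refine (hsum.mul_left (2 * Real.pi * I)⁻¹).congr_fun fun m ↦ ?_
  rw [(hterm m τ).deriv, inv_mul_cancel_left₀ two_pi_I_ne_zero, coeff_thetaDeriv]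

end HasQExp

/-- The `q`-series of the modular forms of weight `k` for `Γ`. -/
def qSeries (Γ : Subgroup (GL (Fin 2) ℝ)) [Γ.HasDetOne] (k : ℤ) : Submodule ℂ ℂ⟦X⟧ where
  carrier := {p | ∃ f : ModularForm Γ k, HasQExp f p}
  zero_mem' := ⟨0, .zero⟩
  add_mem' := fun ⟨f, hf⟩ ⟨g, hg⟩ ↦ ⟨f + g, hf.add hg⟩
  smul_mem' := fun c _ ⟨f, hf⟩ ↦ ⟨c • f, hf.smul c⟩

lemma hasQExp_qExpansion {Γ : Subgroup (GL (Fin 2) ℝ)} {k : ℤ} (hΓ : (1 : ℝ) ∈ Γ.strictPeriods)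
    (f : ModularForm Γ k) : HasQExp f (qExpansion 1 f) :=
  have : Fact (IsCusp OnePoint.infty Γ) := ⟨Γ.isCusp_of_mem_strictPeriods one_pos hΓ⟩
  ModularForm.hasSum_qExpansion f one_pos hΓ

lemma HasQExp.eq_qExpansion {Γ : Subgroup (GL (Fin 2) ℝ)} {k : ℤ} (hΓ : (1 : ℝ) ∈ Γ.strictPeriods)
    {f : ModularForm Γ k} {p : ℂ⟦X⟧} (hf : HasQExp f p) : p = qExpansion 1 f := by
  ext n
  exact ModularFormClass.qExpansion_coeff_unique one_pos hΓ hf n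

namespace qSeries

lemma mul_mem {Γ : Subgroup (GL (Fin 2) ℝ)} [Γ.HasDetOne] {k l : ℤ} {p r : ℂ⟦X⟧}
    (hp : p ∈ qSeries Γ k) (hr : r ∈ qSeries Γ l) : p * r ∈ qSeries Γ (k + l) := by
  obtain ⟨f, hf⟩ := hp
  obtain ⟨g, hg⟩ := hr
  exact ⟨f.mul g, hf.mul hg⟩

lemma mem_of_slash_eq {Γ : Subgroup (GL (Fin 2) ℝ)} [Γ.HasDetOne] (hΓ : Γ ≤ 𝒮ℒ) {k : ℤ}
    {f : ℍ → ℂ} {p : ℂ⟦X⟧} (hf : HasQExp f p) (hslash : ∀ g ∈ Γ, f ∣[k] g = f)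
    (hbdd : ∀ c, IsCusp c 𝒮ℒ → c.IsBoundedAt f k) : p ∈ qSeries Γ k :=
  ⟨{ toFun := f
     slash_action_eq' := hslash
     holo' := hf.mdifferentiable
     bdd_at_cusps' := fun hc ↦ hbdd _ (hc.mono hΓ) }, hf⟩

lemma levelOne_mem_of_slash_eq {k : ℤ} {f : ℍ → ℂ} {p : ℂ⟦X⟧} (hf : HasQExp f p)
    (hslash : ∀ γ : SL(2, ℤ), f ∣[k] γ = f) : p ∈ qSeries 𝒮ℒ k := by
  refine mem_of_slash_eq le_rfl hf ?_ fun c hc ↦ ?_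
  · rintro _ ⟨γ, rfl⟩
    exact hslash γ
  · rw [OnePoint.isBoundedAt_iff_forall_SL2Z hc]
    intro γ _
    rw [hslash]
    exact hf.isBoundedAtImInfty

lemma levelOne_slash_eq {k : ℤ} (f : ModularForm 𝒮ℒ k) (γ : SL(2, ℤ)) : (f : ℍ → ℂ) ∣[k] γ = f :=
  SlashInvariantFormClass.slash_action_eq f _ ⟨γ, rfl⟩

lemma levelOne_eq_zero {k : ℤ} (hk : k.toNat < 12) {p : ℂ⟦X⟧} (hp : p ∈ qSeries 𝒮ℒ k)
    (h0 : constantCoeff p = 0) : p = 0 := by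
  obtain ⟨f, hf⟩ := hp
  have hfp := hf.eq_qExpansion one_mem_strictPeriods_SL
  suffices f = 0 by rw [hfp, this, FunLike.coe_zero, qExpansion_zero]
  apply sturm_bound_levelOne
  rw [← hfp, Nat.div_eq_of_lt hk, Nat.cast_zero, pos_iff_ne_zero,
    order_ne_zero_iff_constCoeff_eq_zero, h0]

lemma exists_coeff_eq_sum {N k : ℕ} {ι : Type*} [Fintype ι]
    (F : Module.Basis ι ℂ (ModForms N k)) {p : ℂ⟦X⟧}
    (hp : p ∈ qSeries ((Gamma0 N).map (mapGL ℝ)) k) :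
    ∃ δ : ι → ℂ, ∀ n, p.coeff n = ∑ i, δ i * modFormCoeff (F i) n := by
  obtain ⟨f, hf⟩ := hp
  have hΓ : (1 : ℝ) ∈ ((Gamma0 N).map (mapGL ℝ)).strictPeriods := by simp
  have hsum := HasQExp.sum Finset.univ fun i _ ↦ (hasQExp_qExpansion hΓ (F i)).smul (F.repr f i)
  have hfsum : (f : ℍ → ℂ) = ∑ i, F.repr f i • (F i : ℍ → ℂ) := by
    simp_rw [← FunLike.coe_smul, ← FunLike.coe_sum, F.sum_repr]
  rw [← hfsum] at hsum
  refine ⟨F.repr f, fun n ↦ ?_⟩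
  rw [hf.eq_qExpansion hΓ, ← hsum.eq_qExpansion hΓ]
  simp [modFormCoeff]

end qSeries

/-! ### Dilations -/

/-- The matrix of `τ ↦ a τ`. -/
noncomputable def dilation (a : ℕ) (ha : a ≠ 0) : GL (Fin 2) ℝ :=
  Matrix.GeneralLinearGroup.mkOfDetNeZero !![(a : ℝ), 0; 0, 1] (by simpa using ha)

section dilation

variable {a : ℕ} (ha : a ≠ 0)

lemma coe_dilation : (dilation a ha).val = !![(a : ℝ), 0; 0, 1] := rfl

lemma det_dilation : (dilation a ha).det.val = a := by
  simp [Matrix.GeneralLinearGroup.val_det_apply, coe_dilation]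

lemma det_dilation_pos : 0 < (dilation a ha).det.val := by
  rw [det_dilation]
  positivity

lemma denom_dilation (z : ℂ) : denom (dilation a ha) z = 1 := by
  simp [denom, coe_dilation]

lemma coe_dilation_smul (τ : ℍ) : ((dilation a ha • τ : ℍ) : ℂ) = a * τ := by
  rw [coe_smul_of_det_pos (det_dilation_pos ha), denom_dilation]
  simp [num, coe_dilation]

lemma slash_dilation_eq (f : ℍ → ℂ) (k : ℤ) :
    f ∣[k] dilation a ha = (a : ℂ) ^ (k - 1) • (f ∘ (dilation a ha • ·)) := by
  ext τ
  rw [slash_apply, denom_dilation, det_dilation, σ, if_pos (det_dilation_pos ha)]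
  simp [mul_comm]

lemma HasQExp.slash_dilation {f : ℍ → ℂ} {p : ℂ⟦X⟧} (hf : HasQExp f p) (k : ℤ) :
    HasQExp (f ∣[k] dilation a ha) ((a : ℂ) ^ (k - 1) • p.expand a ha) := by
  rw [slash_dilation_eq]
  exact (hf.dilate ha (coe_dilation_smul ha)).smul _

lemma exists_dilation_mul_eq {N : ℕ} (hN : a ∣ N) {γ : SL(2, ℤ)} (hγ : γ ∈ Gamma0 N) :
    ∃ γ' : SL(2, ℤ), dilation a ha * mapGL ℝ γ = mapGL ℝ γ' * dilation a ha ∧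
      γ 1 0 = a * γ' 1 0 ∧ γ 1 1 = γ' 1 1 := by
  rw [CongruenceSubgroup.Gamma0_mem, ZMod.intCast_zmod_eq_zero_iff_dvd] at hγ
  obtain ⟨c, hc⟩ := (Int.natCast_dvd_natCast.mpr hN).trans hγ
  have hdet := γ.det_coe
  rw [Matrix.det_fin_two, hc] at hdet
  obtain ⟨γ', h00, h01, h10, h11⟩ : ∃ γ' : SL(2, ℤ),
      γ' 0 0 = γ 0 0 ∧ γ' 0 1 = a * γ 0 1 ∧ γ' 1 0 = c ∧ γ' 1 1 = γ 1 1 := by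
    refine ⟨⟨!![γ 0 0, a * γ 0 1; c, γ 1 1], ?_⟩, rfl, rfl, rfl, rfl⟩
    rw [Matrix.det_fin_two_of]
    linear_combination hdet
  refine ⟨γ', ?_, by rw [h10, hc], h11.symm⟩
  ext i j
  fin_cases i <;> fin_cases j <;>
    simp [Matrix.mul_apply, Fin.sum_univ_two, coe_dilation, hc, h00, h01, h10, h11, mul_comm]

lemma isCusp_dilation_smul {c : OnePoint ℝ} (hc : IsCusp c 𝒮ℒ) :
    IsCusp (dilation a ha • c) 𝒮ℒ := by
  rw [isCusp_SL2Z_iff] at hc ⊢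
  obtain ⟨c, rfl⟩ := hc
  refine ⟨Matrix.GeneralLinearGroup.mkOfDetNeZero !![(a : ℚ), 0; 0, 1] (by simpa using ha) • c, ?_⟩
  rw [← Rat.coe_castHom, OnePoint.map_smul]
  congr 1
  ext i j
  fin_cases i <;> fin_cases j <;> simp [coe_dilation, Matrix.GeneralLinearGroup.mkOfDetNeZero]

lemma isBoundedAt_slash_dilation {f : ℍ → ℂ} {k : ℤ}
    (hf : ∀ γ : SL(2, ℤ), IsBoundedAtImInfty (f ∣[k] γ)) {c : OnePoint ℝ} (hc : IsCusp c 𝒮ℒ) :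
    c.IsBoundedAt (f ∣[k] dilation a ha) k := by
  rw [← OnePoint.IsBoundedAt.smul_iff,
    OnePoint.isBoundedAt_iff_forall_SL2Z (isCusp_dilation_smul ha hc)]
  exact fun γ _ ↦ hf γ

end dilation

lemma Gamma0_map_le (N : ℕ) : (Gamma0 N).map (mapGL ℝ) ≤ 𝒮ℒ := by
  rintro _ ⟨γ, -, rfl⟩
  exact ⟨γ, rfl⟩

namespace qSeries

lemma expand_mem {a N : ℕ} (ha : a ≠ 0) (hN : a ∣ N) {k : ℤ} {p : ℂ⟦X⟧} (hp : p ∈ qSeries 𝒮ℒ k) :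
    p.expand a ha ∈ qSeries ((Gamma0 N).map (mapGL ℝ)) k := by
  obtain ⟨f, hf⟩ := hp
  have hak : (a : ℂ) ^ (k - 1) ≠ 0 := zpow_ne_zero _ (Nat.cast_ne_zero.mpr ha)
  rw [← Submodule.smul_mem_iff _ hak]
  refine mem_of_slash_eq (Gamma0_map_le N) (hf.slash_dilation ha k) ?_ fun c hc ↦
    isBoundedAt_slash_dilation ha (fun γ ↦ ?_) hc
  · rintro _ ⟨γ, hγ, rfl⟩
    obtain ⟨γ', h, -, -⟩ := exists_dilation_mul_eq ha hN hγ
    rw [← SlashAction.slash_mul, h, SlashAction.slash_mul]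
    exact congrArg (· ∣[k] dilation a ha) (levelOne_slash_eq f γ')
  · rw [levelOne_slash_eq]
    exact hf.isBoundedAtImInfty

end qSeries

/-! ### Eisenstein series -/

/-- The `q`-series of `E₂`. -/
noncomputable def eisTwo : ℂ⟦X⟧ := 1 - 24 * sigmaSeries ℂ 1

/-- The `q`-series of `E₄`. -/
noncomputable def eisFour : ℂ⟦X⟧ := 1 + 240 * sigmaSeries ℂ 3

/-- The `q`-series of `a E₂(a τ)`. The factor `a` makes the pair `eisTwoAt a`, `eisFourAt a` satisfy
the same differential equation as `E₂`, `E₄`. -/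
noncomputable def eisTwoAt (a : ℕ) (ha : a ≠ 0) : ℂ⟦X⟧ := (a : ℂ) • eisTwo.expand a ha

/-- The `q`-series of `a² E₄(a τ)`. -/
noncomputable def eisFourAt (a : ℕ) (ha : a ≠ 0) : ℂ⟦X⟧ := (a : ℂ) ^ 2 • eisFour.expand a ha

lemma hasQExp_E2 : HasQExp E2 eisTwo := fun τ ↦ by
  refine (hasSum_qExpansion_E2 (z := τ)).congr_fun fun n ↦ ?_
  simp only [eisTwo, sigmaSeries, ← map_ofNat (C (R := ℂ)), map_sub, coeff_one, coeff_C_mul,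
    coeff_mk, qParam, ofReal_one, div_one]
  by_cases hn : n = 0 <;> simp [hn]

lemma eisFour_mem : eisFour ∈ qSeries 𝒮ℒ 4 := by
  have h : eisFour = qExpansion 1 E₄ := by
    ext n
    rw [E_qExpansion_coeff _ ⟨2, rfl⟩, eisFour, ← map_ofNat (C (R := ℂ)), map_add, coeff_one,
      coeff_C_mul, sigmaSeries, coeff_mk]
    by_cases hn : n = 0
    · simp [hn]
    · norm_num [hn, show bernoulli 4 = -1 / 30 by decide +kernel]
  exact ⟨E₄, h ▸ hasQExp_qExpansion one_mem_strictPeriods_SL E₄⟩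

lemma sub_slash {G α : Type*} [Monoid G] [AddGroup α] [SlashAction ℤ G α] (k : ℤ) (f g : α)
    (γ : G) : (f - g) ∣[k] γ = f ∣[k] γ - g ∣[k] γ := by
  simp [sub_eq_add_neg]

lemma isBoundedAt_sub {c : OnePoint ℝ} {f g : ℍ → ℂ} {k : ℤ} (hf : c.IsBoundedAt f k)
    (hg : c.IsBoundedAt g k) : c.IsBoundedAt (f - g) k := fun γ hγ ↦ by
  rw [sub_slash]
  exact (hf γ hγ).sub (hg γ hγ)

lemma qSeries.serreDerivative_mem {k : ℤ} {p : ℂ⟦X⟧} (hp : p ∈ qSeries 𝒮ℒ k) :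
    (12 : ℂ) • thetaDeriv ℂ p - (k : ℂ) • (eisTwo * p) ∈ qSeries 𝒮ℒ (k + 2) := by
  obtain ⟨f, hf⟩ := hp
  have hser : (12 : ℂ) • D f - (k : ℂ) • (E2 * f) = (12 : ℂ) • serreDerivative k f := by
    ext τ
    simp only [serreDerivative, Pi.sub_apply, Pi.smul_apply, Pi.mul_apply, smul_eq_mul]
    ring
  refine levelOne_mem_of_slash_eq ((hf.normalizedDeriv.smul 12).sub ((hasQExp_E2.mul hf).smul k))
    fun γ ↦ ?_
  rw [hser, SL_smul_slash,
    serreDerivative_slash_invariant hf.mdifferentiable (levelOne_slash_eq f γ)]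

/-- The quasimodular defect `E₂ - E₂|γ` of `E₂` under `γ`. -/
noncomputable def defectE2 (γ : SL(2, ℤ)) : ℍ → ℂ := (1 / (2 * riemannZeta 2)) • D2 γ

lemma E2_slash (γ : SL(2, ℤ)) : E2 ∣[(2 : ℤ)] γ = E2 - defectE2 γ := E2_slash_action γ

lemma defectE2_apply (γ : SL(2, ℤ)) (τ : ℍ) :
    defectE2 γ τ = 6 * I / Real.pi * (γ 1 0 / denom γ τ) := by
  have hπ : (Real.pi : ℂ) ≠ 0 := by exact_mod_cast Real.pi_ne_zero
  simp only [defectE2, D2, riemannZeta_two, Pi.smul_apply, smul_eq_mul]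
  field_simp

lemma mdifferentiable_defectE2 (γ : SL(2, ℤ)) : MDiff (defectE2 γ) := by
  rw [show defectE2 γ = E2 - E2 ∣[(2 : ℤ)] γ by rw [E2_slash, sub_sub_cancel]]
  exact E2_mdifferentiable.sub (E2_mdifferentiable.slash 2 _)

lemma twelve_normalizedDeriv_slash {k : ℤ} {F : ℍ → ℂ} (hF : MDiff F) (γ : SL(2, ℤ)) :
    (12 : ℂ) • D (F ∣[k] γ) =
      (12 : ℂ) • (D F ∣[k + 2] γ) + (k : ℂ) • (defectE2 γ * F ∣[k] γ) := by
  have hπ : (Real.pi : ℂ) ≠ 0 := by exact_mod_cast Real.pi_ne_zero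
  ext τ
  simp only [normalizedDerivOfComplex_SL_slash hF, Pi.add_apply, Pi.sub_apply, Pi.smul_apply,
    Pi.mul_apply, smul_eq_mul, defectE2_apply]
  generalize (γ 1 0 : ℂ) / denom γ τ = c
  field_simp
  linear_combination -(12 * k * c * (F ∣[k] γ) τ) * I_sq

lemma twelve_normalizedDeriv_defectE2 (γ : SL(2, ℤ)) :
    (12 : ℂ) • D (defectE2 γ) = defectE2 γ ^ 2 := by
  have hone : MDiff (1 : ℍ → ℂ) := mdifferentiable_const
  have hD := twelve_normalizedDeriv_slash (k := 1) hone γ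
  have hD1 : D (1 : ℍ → ℂ) = 0 := normalizedDerivOfComplex_const 1
  have hdefect : defectE2 γ = (6 * I / Real.pi * γ 1 0) • ((1 : ℍ → ℂ) ∣[(1 : ℤ)] γ) := by
    ext τ
    simp [defectE2_apply, SL_slash_apply, div_eq_mul_inv, mul_assoc]
  have hu : MDiff ((1 : ℍ → ℂ) ∣[(1 : ℤ)] γ) := hone.slash 1 γ
  rw [hD1, SlashAction.zero_slash, smul_zero, zero_add, Int.cast_one, one_smul] at hD
  generalize (1 : ℍ → ℂ) ∣[(1 : ℤ)] γ = u at *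
  calc (12 : ℂ) • D (defectE2 γ) = (6 * I / Real.pi * γ 1 0 : ℂ) • (12 : ℂ) • D u := by
        rw [hdefect, normalizedDerivOfComplex_smul _ _ hu, smul_comm]
    _ = defectE2 γ * (6 * I / Real.pi * γ 1 0 : ℂ) • u := by rw [hD, mul_smul_comm]
    _ = defectE2 γ ^ 2 := by rw [← hdefect, sq]

lemma twelve_normalizedDeriv_E2_slash (γ : SL(2, ℤ)) :
    (12 : ℂ) • (D E2 ∣[(4 : ℤ)] γ) = (12 : ℂ) • D E2 + (E2 ∣[(2 : ℤ)] γ) ^ 2 - E2 ^ 2 := by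
  have hD := twelve_normalizedDeriv_slash (k := 2) E2_mdifferentiable γ
  have ht := twelve_normalizedDeriv_defectE2 γ
  rw [E2_slash, normalizedDerivOfComplex_sub _ _ E2_mdifferentiable (mdifferentiable_defectE2 γ),
    smul_sub, ht] at hD
  rw [E2_slash]
  simp only [Int.cast_ofNat, ofNat_smul_eq_nsmul, nsmul_eq_mul] at hD ⊢
  push_cast at hD
  linear_combination -hD

lemma eisTwo_mul_eisTwo_sub_mem :
    eisTwo * eisTwo - (12 : ℂ) • thetaDeriv ℂ eisTwo ∈ qSeries 𝒮ℒ 4 := by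
  refine qSeries.levelOne_mem_of_slash_eq
    ((hasQExp_E2.mul hasQExp_E2).sub (hasQExp_E2.normalizedDeriv.smul 12)) fun γ ↦ ?_
  rw [sub_slash, SL_smul_slash, twelve_normalizedDeriv_E2_slash, show (4 : ℤ) = 2 + 2 from rfl,
    mul_slash_SL2]
  ring

/-- Ramanujan's differential equation for `E₂`. -/
lemma twelve_thetaDeriv_eisTwo : (12 : ℂ) • thetaDeriv ℂ eisTwo = eisTwo ^ 2 - eisFour := by
  have h := qSeries.levelOne_eq_zero (by norm_num)
    (Submodule.sub_mem _ eisTwo_mul_eisTwo_sub_mem eisFour_mem)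
    (by simp [eisTwo, eisFour, constantCoeff_thetaDeriv, constantCoeff_sigmaSeries])
  linear_combination -h

lemma isBoundedAtImInfty_defectE2 (γ : SL(2, ℤ)) : IsBoundedAtImInfty (defectE2 γ) := by
  suffices IsBoundedAtImInfty fun τ : ℍ ↦ (γ 1 0 : ℂ) / denom γ τ by
    rw [show defectE2 γ = _ from funext (defectE2_apply γ)]
    exact this.const_mul_left _
  rw [isBoundedAtImInfty_iff]
  refine ⟨1, 1, fun τ hτ ↦ ?_⟩
  have him : (denom γ τ).im = (γ 1 0 : ℤ) * τ.im := by simp [denom]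
  rw [norm_div]
  refine div_le_one_of_le₀ (le_trans ?_ (Complex.abs_im_le_norm _)) (norm_nonneg _)
  rw [him, abs_mul, abs_of_pos τ.im_pos, Complex.norm_intCast]
  exact le_mul_of_one_le_right (abs_nonneg _) hτ

lemma defectE2_slash_dilation {a : ℕ} (ha : a ≠ 0) {γ γ' : SL(2, ℤ)} (h10 : γ 1 0 = a * γ' 1 0)
    (h11 : γ 1 1 = γ' 1 1) : defectE2 γ' ∣[(2 : ℤ)] dilation a ha = defectE2 γ := by
  ext τ
  have hdenom : denom γ' (dilation a ha • τ : ℍ) = denom γ τ := by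
    rw [ModularGroup.denom_apply, ModularGroup.denom_apply, coe_dilation_smul, h10, h11]
    push_cast
    ring
  simp only [slash_dilation_eq, Pi.smul_apply, Function.comp_apply, defectE2_apply, hdenom, h10,
    smul_eq_mul, show (2 : ℤ) - 1 = 1 from rfl, zpow_one]
  push_cast
  ring

lemma eisTwoAt_sub_eisTwo_mem {a N : ℕ} (ha : a ≠ 0) (hN : a ∣ N) :
    eisTwoAt a ha - eisTwo ∈ qSeries ((Gamma0 N).map (mapGL ℝ)) 2 := by
  have hE2a := hasQExp_E2.slash_dilation ha 2
  rw [show (2 : ℤ) - 1 = 1 from rfl, zpow_one] at hE2a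
  have hE2bdd (γ : SL(2, ℤ)) : IsBoundedAtImInfty (E2 ∣[(2 : ℤ)] γ) := by
    rw [E2_slash]
    exact isBoundedAtImInfty_E2.sub (isBoundedAtImInfty_defectE2 γ)
  refine qSeries.mem_of_slash_eq (Gamma0_map_le N) (hE2a.sub hasQExp_E2) ?_ fun c hc ↦ ?_
  · rintro _ ⟨γ, hγ, rfl⟩
    obtain ⟨γ', h, h10, h11⟩ := exists_dilation_mul_eq ha hN hγ
    have hE2γ (γ : SL(2, ℤ)) : E2 ∣[(2 : ℤ)] mapGL ℝ γ = E2 - defectE2 γ := E2_slash γ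
    rw [sub_slash, ← SlashAction.slash_mul, h, SlashAction.slash_mul, hE2γ, hE2γ, sub_slash,
      defectE2_slash_dilation ha h10 h11, sub_sub_sub_cancel_right]
  · refine isBoundedAt_sub (isBoundedAt_slash_dilation ha hE2bdd hc) ?_
    rw [OnePoint.isBoundedAt_iff_forall_SL2Z hc]
    exact fun γ _ ↦ hE2bdd γ

/-! ### Convolution sums -/

lemma coeff_expand_sigmaSeries {R : Type*} [CommRing R] {a : ℕ} (ha : a ≠ 0) (k n : ℕ) :
    ((sigmaSeries R k).expand a ha).coeff n = atQuot (ArithmeticFunction.sigma k) n a := by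
  rw [coeff_expand, atQuot]
  split_ifs <;> simp [sigmaSeries]

lemma coeff_expand_mul_expand {R : Type*} [CommRing R] {a b : ℕ} (ha : a ≠ 0) (hb : b ≠ 0)
    {p r : R⟦X⟧} (hp : constantCoeff p = 0) (hr : constantCoeff r = 0) (n : ℕ) :
    (p.expand a ha * r.expand b hb).coeff n =
      ∑ x ∈ (Finset.Icc 1 n ×ˢ Finset.Icc 1 n).filter (fun x : ℕ × ℕ ↦ a * x.1 + b * x.2 = n),
        p.coeff x.1 * r.coeff x.2 := by
  rw [coeff_mul]
  symm
  refine Finset.sum_of_injOn (fun x ↦ (a * x.1, b * x.2)) ?_ ?_ ?_ ?_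
  · rintro ⟨x, y⟩ - ⟨x', y'⟩ - h
    simp only [Prod.mk.injEq, mul_eq_mul_left_iff, ha, hb, or_false] at h
    exact Prod.ext h.1 h.2
  · rintro ⟨x, y⟩ h
    simpa using (Finset.mem_filter.mp h).2
  · rintro ⟨u, v⟩ huv hnot
    rw [Finset.HasAntidiagonal.mem_antidiagonal] at huv
    by_contra hne
    obtain ⟨hu, hv⟩ := ne_zero_and_ne_zero_of_mul hne
    obtain ⟨x, rfl⟩ : a ∣ u := not_imp_comm.mp (coeff_expand_of_not_dvd a ha p) hu
    obtain ⟨y, rfl⟩ : b ∣ v := not_imp_comm.mp (coeff_expand_of_not_dvd b hb r) hv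
    have hx : x ≠ 0 := by
      rintro rfl
      simp [hp] at hu
    have hy : y ≠ 0 := by
      rintro rfl
      simp [hr] at hv
    have hxa := Nat.le_mul_of_pos_left x (Nat.pos_of_ne_zero ha)
    have hyb := Nat.le_mul_of_pos_left y (Nat.pos_of_ne_zero hb)
    refine hnot ⟨(x, y), ?_, rfl⟩
    simp only [Finset.coe_filter, Finset.mem_product, Finset.mem_Icc, Set.mem_ofPred_eq]
    omega
  · rintro ⟨x, y⟩ -
    rw [coeff_expand_mul, coeff_expand_mul]

lemma coeff_sigmaSeries_mul {R : Type*} [CommRing R] {a b : ℕ} (ha : a ≠ 0) (hb : b ≠ 0)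
    (r s n : ℕ) :
    ((sigmaSeries R r).expand a ha * (sigmaSeries R s).expand b hb).coeff n =
      convSum 0 r s a b n := by
  rw [coeff_expand_mul_expand _ _ (constantCoeff_sigmaSeries R r) (constantCoeff_sigmaSeries R s),
    convSum]
  push_cast
  simp only [sigmaSeries, coeff_mk, pow_zero, one_mul]

lemma coeff_thetaDeriv_sigmaSeries_mul {R : Type*} [CommRing R] {a b : ℕ} (ha : a ≠ 0)
    (hb : b ≠ 0) (r s n : ℕ) :
    ((thetaDeriv R (sigmaSeries R r)).expand a ha * (sigmaSeries R s).expand b hb).coeff n =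
      convSum 1 r s a b n := by
  rw [coeff_expand_mul_expand _ _ (constantCoeff_thetaDeriv _) (constantCoeff_sigmaSeries R s),
    convSum]
  push_cast
  simp only [coeff_thetaDeriv, sigmaSeries, coeff_mk, pow_one]

lemma coeff_expand_thetaDeriv_sigmaSeries_mul {R : Type*} [CommRing R] {a : ℕ} (ha : a ≠ 0)
    (r s n : ℕ) :
    ((thetaDeriv R (sigmaSeries R r) * sigmaSeries R s).expand a ha).coeff n =
      atQuot (convSum 1 r s 1 1) n a := by
  have h (m : ℕ) := coeff_thetaDeriv_sigmaSeries_mul (R := R) one_ne_zero one_ne_zero r s m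
  simp only [expand_one_apply] at h
  rw [coeff_expand, atQuot]
  split_ifs <;> simp [h]

lemma eisTwo_mul_eisFour_sub_mem :
    eisTwo * eisFour - (3 : ℂ) • thetaDeriv ℂ eisFour ∈ qSeries 𝒮ℒ 6 := by
  have h := Submodule.smul_mem _ (-1 / 4 : ℂ) (qSeries.serreDerivative_mem eisFour_mem)
  rw [show (4 : ℤ) + 2 = 6 from rfl, Int.cast_ofNat] at h
  convert h using 1
  module

section eisTwoAt

variable {a b N : ℕ} (ha : a ≠ 0) (hb : b ≠ 0)

lemma eisTwoAt_eq : eisTwoAt a ha = C (a : ℂ) - C (24 * a : ℂ) * (sigmaSeries ℂ 1).expand a ha := by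
  simp only [eisTwoAt, eisTwo, map_sub, map_mul, map_one, map_ofNat, smul_eq_C_mul]
  ring

lemma eisFourAt_eq :
    eisFourAt a ha = C ((a : ℂ) ^ 2) * (1 + 240 * (sigmaSeries ℂ 3).expand a ha) := by
  rw [eisFourAt, eisFour, map_add, map_mul, map_one, map_ofNat, smul_eq_C_mul]

lemma twelve_thetaDeriv_eisTwoAt :
    12 * thetaDeriv ℂ (eisTwoAt a ha) = eisTwoAt a ha ^ 2 - eisFourAt a ha := by
  have h := congrArg (expand a ha) twelve_thetaDeriv_eisTwo
  rw [eisTwoAt, eisFourAt, Derivation.map_smul, thetaDeriv_expand]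
  simp only [smul_eq_C_mul, map_sub, map_pow, map_mul, map_ofNat] at h ⊢
  linear_combination C (a : ℂ) ^ 2 * h

lemma eisTwoAt_sub_mem (haN : a ∣ N) (hbN : b ∣ N) :
    eisTwoAt a ha - eisTwoAt b hb ∈ qSeries ((Gamma0 N).map (mapGL ℝ)) 2 := by
  rw [← sub_sub_sub_cancel_right _ _ eisTwo]
  exact Submodule.sub_mem _ (eisTwoAt_sub_eisTwo_mem ha haN) (eisTwoAt_sub_eisTwo_mem hb hbN)

lemma eisFourAt_mem (haN : a ∣ N) :
    eisFourAt a ha ∈ qSeries ((Gamma0 N).map (mapGL ℝ)) 4 :=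
  Submodule.smul_mem _ _ (qSeries.expand_mem ha haN eisFour_mem)

lemma eisTwoAt_mul_eisFourAt_sub_mem (haN : a ∣ N) :
    eisTwoAt a ha * eisFourAt a ha - 3 * thetaDeriv ℂ (eisFourAt a ha) ∈
      qSeries ((Gamma0 N).map (mapGL ℝ)) 6 := by
  convert Submodule.smul_mem _ ((a : ℂ) ^ 3)
    (qSeries.expand_mem ha haN eisTwo_mul_eisFour_sub_mem) using 1
  rw [eisTwoAt, eisFourAt, Derivation.map_smul, thetaDeriv_expand, map_sub, map_mul, map_smul]
  simp only [smul_eq_C_mul, map_pow, map_ofNat]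
  ring

end eisTwoAt

/-- For `x = a E₂(a τ)` and `y = b E₂(b τ)` the right-hand side is visibly modular, because the
quasimodular parts cancel in `x - y`, `x P - 3 d P` and `y Q - 3 d Q`. -/
lemma combination_eq_of_twelve_derivation_eq {R A : Type*} [CommSemiring R] [CommRing A]
    [Algebra R A] (d : Derivation R A A) {x y P Q : A} (hx : 12 * d x = x ^ 2 - P)
    (hy : 12 * d y = y ^ 2 - Q) :
    72 * (y * d x) - 36 * d (x * y) + 4 * (P * y) + 72 * d (d x) + 72 * d (d y) - 24 * (x * d x) =
      2 * (x * P - 3 * d P) + 2 * (y * Q - 3 * d Q) - (P - 3 * Q) * (x - y) - (x - y) ^ 3 := by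
  have hdiff {z S : A} (hz : 12 * d z = z ^ 2 - S) : 12 * d (d z) = 2 * (z * d z) - d S := by
    have h := congrArg d hz
    rw [← Nat.ofNat_nsmul_eq_mul, map_nsmul, map_sub, d.leibniz_pow] at h
    simpa using h
  rw [d.leibniz, smul_eq_mul, smul_eq_mul]
  linear_combination 6 * hdiff hx + 6 * hdiff hy + (3 * y - x) * hx + (y - 3 * x) * hy

/-- The weight six series whose coefficients carry the convolution sums of `σ`. It is assembled
from `x = a E₂(a τ)`, `y = b E₂(b τ)` and `P = a² E₄(a τ)`. -/
noncomputable def convolutionSeries (a b : ℕ) (ha : a ≠ 0) (hb : b ≠ 0) : ℂ⟦X⟧ :=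
  let θ := thetaDeriv ℂ
  let x := eisTwoAt a ha
  let y := eisTwoAt b hb
  72 * (y * θ x) - 36 * θ (x * y) + 4 * (eisFourAt a ha * y) + 72 * θ (θ x) + 72 * θ (θ y) -
    24 * (x * θ x)

lemma convolutionSeries_mem {a b N : ℕ} (ha : a ≠ 0) (hb : b ≠ 0) (haN : a ∣ N) (hbN : b ∣ N) :
    convolutionSeries a b ha hb ∈ qSeries ((Gamma0 N).map (mapGL ℝ)) 6 := by
  have hxy := eisTwoAt_sub_mem ha hb haN hbN
  have hPQ := Submodule.sub_mem _ (eisFourAt_mem ha haN)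
    (Submodule.smul_mem _ (3 : ℂ) (eisFourAt_mem hb hbN))
  have hxP := Submodule.smul_mem _ (2 : ℂ) (eisTwoAt_mul_eisFourAt_sub_mem ha haN)
  have hyQ := Submodule.smul_mem _ (2 : ℂ) (eisTwoAt_mul_eisFourAt_sub_mem hb hbN)
  convert Submodule.sub_mem _ (Submodule.sub_mem _ (Submodule.add_mem _ hxP hyQ)
    (qSeries.mul_mem hPQ hxy)) (qSeries.mul_mem hxy (qSeries.mul_mem hxy hxy)) using 1
  rw [convolutionSeries, combination_eq_of_twelve_derivation_eq _ (twelve_thetaDeriv_eisTwoAt ha)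
    (twelve_thetaDeriv_eisTwoAt hb)]
  simp only [smul_eq_C_mul, map_ofNat]
  ring

lemma convolutionSeries_eq {a b : ℕ} (ha : a ≠ 0) (hb : b ≠ 0) :
    let s := (sigmaSeries ℂ 1).expand a ha
    let t := (sigmaSeries ℂ 1).expand b hb
    let u := (sigmaSeries ℂ 3).expand a ha
    let θ := thetaDeriv ℂ
    convolutionSeries a b ha hb = C (4 * (a : ℂ) ^ 2 * b)
      + C (41472 * (a : ℂ) ^ 2 * b) * ((θ (sigmaSeries ℂ 1)).expand a ha * t)
      - C (1728 * (a : ℂ)) * θ (θ s) - C (864 * (a : ℂ) * b) * θ s + C (576 * (a : ℂ) ^ 2) * θ s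
      - C (1728 * (b : ℂ)) * θ (θ t) + C (864 * (a : ℂ) * b) * θ t
      - C (96 * (a : ℂ) ^ 2 * b) * t + C (960 * (a : ℂ) ^ 2 * b) * u
      - C (20736 * (a : ℂ) * b) * θ (s * t) - C (23040 * (a : ℂ) ^ 2 * b) * (t * u)
      - C (13824 * (a : ℂ) ^ 3) * (θ (sigmaSeries ℂ 1) * sigmaSeries ℂ 1).expand a ha := by
  have hθC (c : ℂ) : thetaDeriv ℂ (C c) = 0 := (thetaDeriv ℂ).map_algebraMap c
  simp only [convolutionSeries, eisTwoAt_eq, eisFourAt_eq, map_sub, map_add, Derivation.leibniz,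
    thetaDeriv_expand, smul_eq_C_mul, smul_eq_mul, hθC, map_zero]
  simp only [map_mul, map_pow, map_ofNat]
  ring

lemma coeff_convolutionSeries {a b n : ℕ} (ha : a ≠ 0) (hb : b ≠ 0) (hn : n ≠ 0) :
    (convolutionSeries a b ha hb).coeff n = 41472 * a ^ 2 * b * convSum 1 1 1 a b n
      - (1728 * a * n ^ 2 + 864 * a * b * n - 576 * a ^ 2 * n)
          * atQuot (ArithmeticFunction.sigma 1) n a
      - (1728 * b * n ^ 2 - 864 * a * b * n + 96 * a ^ 2 * b)
          * atQuot (ArithmeticFunction.sigma 1) n b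
      + 960 * a ^ 2 * b * atQuot (ArithmeticFunction.sigma 3) n a
      - 20736 * a * b * n * convSum 0 1 1 a b n - 23040 * a ^ 2 * b * convSum 0 1 3 b a n
      - 13824 * a ^ 3 * atQuot (convSum 1 1 1 1 1) n a := by
  rw [convolutionSeries_eq]
  simp only [map_add, map_sub, coeff_C_mul, coeff_C, hn, if_false, coeff_thetaDeriv,
    coeff_expand_sigmaSeries, coeff_sigmaSeries_mul, coeff_thetaDeriv_sigmaSeries_mul,
    coeff_expand_thetaDeriv_sigmaSeries_mul]
  ring

theorem theorem3p2_general {a b N : ℕ} (ha : a ≠ 0) (hb : b ≠ 0) (haN : a ∣ N) (hbN : b ∣ N)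
    {ι : Type*} [Fintype ι] (F : Module.Basis ι ℂ (ModForms N 6)) :
    ∃ δ : ι → ℂ, ∀ n : ℕ, n ≠ 0 →
      (convSum 1 1 1 a b n : ℂ) =
        1 / (144 * (a : ℂ)) * (6 / (b : ℂ) * (n : ℂ) ^ 2 + 3 * (n : ℂ)
            - 2 * (a : ℂ) * (n : ℂ) / (b : ℂ)) * (atQuot (ArithmeticFunction.sigma 1) n a : ℂ)
        + 1 / (144 * (a : ℂ)) * (6 / (a : ℂ) * (n : ℂ) ^ 2 - 3 * (n : ℂ)
            + (a : ℂ) / 3) * (atQuot (ArithmeticFunction.sigma 1) n b : ℂ)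
        - 5 / 216 * (atQuot (ArithmeticFunction.sigma 3) n a : ℂ)
        + (n : ℂ) / (2 * (a : ℂ)) * (convSum 0 1 1 a b n : ℂ)
        + 5 / 9 * (convSum 0 1 3 b a n : ℂ)
        + (a : ℂ) / (3 * (b : ℂ)) * (atQuot (convSum 1 1 1 1 1) n a : ℂ)
        + 1 / (6 * 576 * (a : ℂ)) * ∑ i, δ i * modFormCoeff (F i) n := by
  obtain ⟨δ, hδ⟩ := qSeries.exists_coeff_eq_sum F (convolutionSeries_mem ha hb haN hbN)
  refine ⟨fun i ↦ 1 / (12 * a * b) * δ i, fun n hn ↦ ?_⟩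
  have ha' : (a : ℂ) ≠ 0 := Nat.cast_ne_zero.mpr ha
  have hb' : (b : ℂ) ≠ 0 := Nat.cast_ne_zero.mpr hb
  simp only [mul_assoc (1 / (12 * a * b : ℂ)), ← Finset.mul_sum]
  rw [← hδ, coeff_convolutionSeries ha hb hn]
  field_simp
  ring

end

theorem theorem3p2 (a b : ℕ) (ha : 0 < a) (hb : 0 < b) (hab : Nat.Coprime a b)
    (hab1 : 1 < a ∨ 1 < b)
    (F : Module.Basis (Fin (Module.finrank ℂ (ModForms (a * b) 6))) ℂ (ModForms (a * b) 6)) :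
    ∃ δ : Fin (Module.finrank ℂ (ModForms (a * b) 6)) → ℂ, ∀ n : ℕ, 2 ≤ n →
      (convSum 1 1 1 a b n : ℂ) =
        1 / (144 * (a : ℂ)) * (6 / (b : ℂ) * (n : ℂ) ^ 2 + 3 * (n : ℂ)
            - 2 * (a : ℂ) * (n : ℂ) / (b : ℂ)) * (atQuot (ArithmeticFunction.sigma 1) n a : ℂ)
        + 1 / (144 * (a : ℂ)) * (6 / (a : ℂ) * (n : ℂ) ^ 2 - 3 * (n : ℂ)
            + (a : ℂ) / 3) * (atQuot (ArithmeticFunction.sigma 1) n b : ℂ)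
        - 5 / 216 * (atQuot (ArithmeticFunction.sigma 3) n a : ℂ)
        + (n : ℂ) / (2 * (a : ℂ)) * (convSum 0 1 1 a b n : ℂ)
        + 5 / 9 * (convSum 0 1 3 b a n : ℂ)
        + (a : ℂ) / (3 * (b : ℂ)) * (atQuot (convSum 1 1 1 1 1) n a : ℂ)
        + 1 / (6 * 576 * (a : ℂ)) * ∑ i, δ i * modFormCoeff (F i) n := by
  exact (theorem3p2_general ha.ne' hb.ne' (Dvd.intro _ rfl) (Dvd.intro_left _ rfl) F).imp
    fun _ h n hn ↦ h n (by omega)
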